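/- Let $\sigma>0$ and consider the discrete-time Gaussian channel with one-bit output quantization: a real input $x_k$ is received as $\tilde Y_k=x_k+Z_k$, where the $Z_k$ are i.i.d. centred Gaussian with variance $\sigma^2$, and the decoder observes $Y_k=1$ if $\tilde Y_k\in\mathcal D$ and $Y_k=-1$ otherwise, where the quantization region $\mathcal D\subset\mathbb R$ is a Borel set. A code of energy $\mathsf E$ consists of an encoder mapping each message $m\in\{1,\dots,\mathsf M\}$ to a sequence $(x_1(m),\dots,x_n(m))\in\mathbb R^n$ with $\sum_{k=1}^n x_k(m)^2\le\mathsf E$, a quantization region $\mathcal D$, and a decoder producing a guess $\hat M$ of the message from $Y_1,\dots,Y_n$; the message $M$ is uniformly distributed on $\{1,\dots,\mathsf M\}$ and independent of the noise. A rate per unit-energy $R$ (in nats per energy) is achievable if for every $\varepsilon>0$ there are codes of energy $\mathsf E$, for all $\mathsf E$, such that $\frac{\log\mathsf M}{\mathsf E}>R-\varepsilon$ for all sufficiently large $\mathsf E$ and $\Pr(\hat M\ne M)\to0$ as $\mathsf E\to\infty$. The capacity per unit-energy $\dot C(0)$ is the supremum of all achievable rates per unit-energy. Then $$\dot C(0)=\frac1{2\sigma^2},$$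 which equals the capacity per unit-energy (defined in the same way) of the Gaussian channel without output quantization, where the decoder observes $\tilde Y_1,\dots,\tilde Y_n$. Moreover, the capacity per unit-energy is achieved by threshold quantizers: for every $\varepsilon>0$ there are a threshold $\Upsilon\in\mathbb R$ and codes of energy $\mathsf E$, for all $\mathsf E$, that all use the quantization region $\mathcal D=\{\tilde y\in\mathbb R:\tilde y\ge\Upsilon\}$, such that $\frac{\log\mathsf M}{\mathsf E}>\frac1{2\sigma^2}-\varepsilon$ for all sufficiently large $\mathsf E$ and $\Pr(\hat M\neq M)\to0$ as $\mathsf E\to\infty$. (The threshold is chosen together with the encoder and may depend on $\varepsilon$.) -/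

import Mathlib

open MeasureTheory ProbabilityTheory Filter Topology
open scoped NNReal

noncomputable section

namespace OneBit

/-- Law of the noise vector `(Z_1, …, Z_n)`: i.i.d. centred Gaussians of variance `σ ^ 2`. -/
def noise (σ : ℝ) (n : ℕ) : Measure (Fin n → ℝ) :=
  Measure.pi fun _ => gaussianReal 0 (σ ^ 2).toNNReal

open Classical in
/-- The one-bit quantizer with quantization region `D`: it produces `1` on `D` and `-1` off `D`. -/
def quantize (D : Set ℝ) (y : ℝ) : ℤˣ := if y ∈ D then 1 else -1

/-- An encoder that maps each of `M` messages to a real sequence of length `n` whose energy does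
not exceed `E`. -/
structure Encoder (E : ℝ≥0) where
  n : ℕ
  M : ℕ
  M_pos : 0 < M
  codeword : Fin M → Fin n → ℝ
  energy_le : ∀ m, ∑ k, codeword m k ^ 2 ≤ (E : ℝ)

/-- The rate per unit-energy `log M / E`, in nats per energy. -/
def Encoder.rate {E : ℝ≥0} (c : Encoder E) : ℝ := Real.log c.M / E

/-- An encoder, a one-bit quantizer (used at every time instant) and a decoder that observes the
quantizer's outputs. -/
structure QuantizedCode (E : ℝ≥0) extends Encoder E where
  region : Set ℝ
  measurableSet_region : MeasurableSet region
  decoder : (Fin n → ℤˣ) → Fin M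

/-- Probability of error for a uniformly distributed message, when the sequence `x` is received as
`x + Z` and then quantized componentwise. -/
def QuantizedCode.errorProb {E : ℝ≥0} (c : QuantizedCode E) (σ : ℝ) : ℝ :=
  (∑ m, (noise σ c.n).real
    {z | c.decoder (fun k => quantize c.region (c.codeword m k + z k)) ≠ m}) / c.M

/-- An encoder and a decoder that observes the unquantized channel outputs. -/
structure UnquantizedCode (E : ℝ≥0) extends Encoder E where
  decoder : (Fin n → ℝ) → Fin M
  measurable_decoder : Measurable decoder

/-- Probability of error for a uniformly distributed message, without quantization. -/
def UnquantizedCode.errorProb {E : ℝ≥0} (c : UnquantizedCode E) (σ : ℝ) : ℝ :=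
  (∑ m, (noise σ c.n).real {z | c.decoder (fun k => c.codeword m k + z k) ≠ m}) / c.M

/-- `R` is an achievable rate per unit-energy of the channel with one-bit output quantization: for
every `ε > 0` there are codes, one for each energy `E`, whose rate per unit-energy exceeds `R - ε`
and whose probability of error tends to zero as `E` tends to infinity. -/
def IsAchievable (σ R : ℝ) : Prop :=
  ∀ ε : ℝ, 0 < ε → ∃ code : ∀ E : ℝ≥0, QuantizedCode E,
    (∀ᶠ E in atTop, R - ε < (code E).rate) ∧
      Tendsto (fun E => (code E).errorProb σ) atTop (𝓝 0)

/-- The same notion for the channel without output quantization. -/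
def IsAchievableUnquantized (σ R : ℝ) : Prop :=
  ∀ ε : ℝ, 0 < ε → ∃ code : ∀ E : ℝ≥0, UnquantizedCode E,
    (∀ᶠ E in atTop, R - ε < (code E).rate) ∧
      Tendsto (fun E => (code E).errorProb σ) atTop (𝓝 0)

/-- `R` is achievable with threshold quantizers: for every `ε > 0` there is a threshold `Υ` such
that codes as above exist which all use the quantization region `{y | Υ ≤ y}`. -/
def IsAchievableByThreshold (σ R : ℝ) : Prop :=
  ∀ ε : ℝ, 0 < ε → ∃ Υ : ℝ, ∃ code : ∀ E : ℝ≥0, QuantizedCode E,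
    (∀ E, (code E).region = {y : ℝ | Υ ≤ y}) ∧
      (∀ᶠ E in atTop, R - ε < (code E).rate) ∧
        Tendsto (fun E => (code E).errorProb σ) atTop (𝓝 0)

/-- Capacity per unit-energy of the Gaussian channel with one-bit output quantization: the supremum
of all achievable rates per unit-energy. -/
def capacityPerUnitEnergy (σ : ℝ) : EReal :=
  ⨆ R ∈ {R : ℝ | IsAchievable σ R}, (R : EReal)

/-- Capacity per unit-energy of the Gaussian channel without output quantization. -/
def capacityPerUnitEnergyUnquantized (σ : ℝ) : EReal :=
  ⨆ R ∈ {R : ℝ | IsAchievableUnquantized σ R}, (R : EReal)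

end OneBit

end

/-!
Converse: the law of the received sequence has density `exp (logLikelihoodRatio v x)` with respect
to the noise law, and for a codeword of energy at most `E` this log-likelihood ratio concentrates
below `E / (2 σ²) + o(E)`. Since the decoding regions are disjoint, about `exp (E / (2 σ²))`
messages are all that can be told apart. A quantizer can only lose, as a decoder may quantize by
itself.

Achievability: message `m` is sent as pulses of a large amplitude `ξ` in the `m`-th of `M` blocks,
which fits into the energy if blocks have length `L = ⌊E / ξ²⌋`. With the threshold at
`(1 - η) ξ`, a single output of a silent instant is `1` with probability about
`exp (-(1 - η)² ξ² / (2 σ²))`; a fraction `1 - η` of such outputs in a block of length `L` thus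
has probability about `exp (-(1 - η)³ E / (2 σ²))`, which beats the number of messages for every
rate below `(1 - η)³ / (2 σ²)`.
-/

namespace OneBit

/-! ### Change of measure -/

section ChangeOfMeasure

variable {Ω : Type*} [MeasurableSpace Ω]

lemma withDensity_measureReal_le (Q : Measure Ω) [IsFiniteMeasure Q] (f : Ω → ℝ)
    [IsFiniteMeasure (Q.withDensity fun y => ENNReal.ofReal (f y))] {T : ℝ} (hT : 0 ≤ T)
    (A : Set Ω) :
    (Q.withDensity fun y => ENNReal.ofReal (f y)).real A ≤
      (Q.withDensity fun y => ENNReal.ofReal (f y)).real {y | T < f y} + T * Q.real A := by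
  set P := Q.withDensity fun y => ENNReal.ofReal (f y) with hP
  set S := {y | T < f y}
  have hdiff : P (A \ S) ≤ ENNReal.ofReal T * Q A := by
    rw [hP, withDensity_apply']
    calc ∫⁻ y in A \ S, ENNReal.ofReal (f y) ∂Q
        ≤ ∫⁻ _ in A \ S, ENNReal.ofReal T ∂Q :=
          setLIntegral_mono measurable_const fun y hy => ENNReal.ofReal_le_ofReal (not_lt.1 hy.2)
      _ = ENNReal.ofReal T * Q (A \ S) := setLIntegral_const _ _
      _ ≤ ENNReal.ofReal T * Q A := by gcongr; exact Set.sdiff_subset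
  have hdiff' : P.real (A \ S) ≤ T * Q.real A := by
    have h := ENNReal.toReal_mono (by finiteness) hdiff
    rwa [ENNReal.toReal_mul, ENNReal.toReal_ofReal hT] at h
  calc P.real A ≤ P.real (S ∪ A \ S) := measureReal_mono (by simp)
    _ ≤ P.real S + P.real (A \ S) := measureReal_union_le _ _
    _ ≤ P.real S + T * Q.real A := by gcongr

lemma card_le_sum_measureReal_ne_add {ι : Type*} [Fintype ι] [MeasurableSpace ι]
    [MeasurableSingletonClass ι] {P : ι → Measure Ω} [∀ i, IsProbabilityMeasure (P i)]
    {Q : Measure Ω} [IsProbabilityMeasure Q] {d : Ω → ι} (hd : Measurable d) {a T : ℝ}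
    (h : ∀ i, (P i).real (d ⁻¹' {i}) ≤ a + T * Q.real (d ⁻¹' {i})) :
    (Fintype.card ι : ℝ) ≤ ∑ i, (P i).real {y | d y ≠ i} + Fintype.card ι * a + T := by
  have hd' (i : ι) : MeasurableSet (d ⁻¹' {i}) := hd (measurableSet_singleton i)
  have hmsg (i : ι) : 1 ≤ (P i).real {y | d y ≠ i} + (a + T * Q.real (d ⁻¹' {i})) := by
    have hcompl : (P i).real {y | d y ≠ i} = 1 - (P i).real (d ⁻¹' {i}) :=
      probReal_compl_eq_one_sub (hd' i)
    linarith [h i]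
  have htotal : ∑ i, Q.real (d ⁻¹' {i}) = 1 := by
    rw [sum_measureReal_preimage_singleton _ fun i _ => hd' i]
    simp
  calc (Fintype.card ι : ℝ) = ∑ _i : ι, (1 : ℝ) := by simp
    _ ≤ ∑ i, ((P i).real {y | d y ≠ i} + (a + T * Q.real (d ⁻¹' {i}))) :=
      Finset.sum_le_sum fun i _ => hmsg i
    _ = ∑ i, (P i).real {y | d y ≠ i} + Fintype.card ι * a + T := by
      simp only [Finset.sum_add_distrib, ← Finset.mul_sum, htotal, Finset.sum_const,
        Finset.card_univ, nsmul_eq_mul]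
      ring

lemma pi_withDensity_ofReal {ι : Type*} [Fintype ι] {X : ι → Type*} [∀ i, MeasurableSpace (X i)]
    (μ : ∀ i, Measure (X i)) [∀ i, SigmaFinite (μ i)] {f : ∀ i, X i → ℝ}
    (hf : ∀ i, Integrable (f i) (μ i)) (hf₀ : ∀ i x, 0 ≤ f i x) :
    Measure.pi (fun i => (μ i).withDensity fun x => ENNReal.ofReal (f i x)) =
      (Measure.pi μ).withDensity fun x => ENNReal.ofReal (∏ i, f i (x i)) := by
  have hσ (i : ι) : SigmaFinite ((μ i).withDensity fun x => ENNReal.ofReal (f i x)) :=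
    SigmaFinite.withDensity_ofReal (f i)
  refine Measure.pi_eq fun s hs => ?_
  rw [withDensity_apply _ (MeasurableSet.univ_pi hs), Measure.restrict_pi_pi,
    ← ofReal_integral_eq_lintegral_ofReal
      (Integrable.fintype_prod_dep fun i => (hf i).restrict)
      (ae_of_all _ fun x => Finset.prod_nonneg fun i _ => hf₀ i _),
    integral_fintype_prod_eq_prod,
    ENNReal.ofReal_prod_of_nonneg fun i _ => integral_nonneg (hf₀ i)]
  refine Finset.prod_congr rfl fun i _ => ?_
  rw [withDensity_apply _ (hs i),
    ofReal_integral_eq_lintegral_ofReal (hf i).restrict (ae_of_all _ (hf₀ i))]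

end ChangeOfMeasure

/-! ### Gaussian measures -/

section Gaussian

variable {ι : Type*} [Fintype ι] {v : ℝ≥0}

lemma hasSubgaussianMGF_id_gaussianReal (v : ℝ≥0) :
    HasSubgaussianMGF id v (gaussianReal 0 v) where
  integrable_exp_mul t := integrable_exp_mul_gaussianReal t
  mgf_le t := by simp [mgf_id_gaussianReal]

lemma gaussianReal_Ici_le (v : ℝ≥0) {a : ℝ} (ha : 0 ≤ a) :
    (gaussianReal 0 v).real (Set.Ici a) ≤ Real.exp (-a ^ 2 / (2 * v)) :=
  (hasSubgaussianMGF_id_gaussianReal v).measure_ge_le ha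

lemma gaussianReal_Iio_neg_le (v : ℝ≥0) {a : ℝ} (ha : 0 ≤ a) :
    (gaussianReal 0 v).real (Set.Iio (-a)) ≤ Real.exp (-a ^ 2 / (2 * v)) := by
  refine le_trans (measureReal_mono fun z hz => ?_)
    ((hasSubgaussianMGF_id_gaussianReal v).neg.measure_ge_le ha)
  exact le_neg_of_le_neg (Set.mem_Iio.1 hz).le

lemma hasSubgaussianMGF_sum_mul {E : ℝ≥0} {x : ι → ℝ} (hx : ∑ k, x k ^ 2 ≤ (E : ℝ)) :
    HasSubgaussianMGF (fun z : ι → ℝ => ∑ k, x k * z k) (E * v)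
      (Measure.pi fun _ => gaussianReal 0 v) := by
  have hindep : iIndepFun (fun k (z : ι → ℝ) => x k * z k)
      (Measure.pi fun _ => gaussianReal 0 v) :=
    iIndepFun_pi (X := fun k z => x k * z) fun k => by fun_prop
  have hcoord (k : ι) : HasSubgaussianMGF (fun z : ι → ℝ => z k) v
      (Measure.pi fun _ => gaussianReal 0 v) := by
    refine HasSubgaussianMGF.of_map (X := id) (measurable_pi_apply k).aemeasurable ?_
    rw [(measurePreserving_eval (fun _ => gaussianReal 0 v) k).map_eq]
    exact hasSubgaussianMGF_id_gaussianReal v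
  have hterm (k : ι) : HasSubgaussianMGF (fun z : ι → ℝ => x k * z k)
      ((x k ^ 2).toNNReal * v) (Measure.pi fun _ => gaussianReal 0 v) := by
    rw [Real.toNNReal_of_nonneg (sq_nonneg (x k))]
    exact (hcoord k).const_mul (x k)
  have hsum := HasSubgaussianMGF.sum_of_iIndepFun hindep (s := Finset.univ) fun k _ => hterm k
  refine ⟨hsum.integrable_exp_mul, fun t => (hsum.mgf_le t).trans ?_⟩
  gcongr
  rw [← Finset.sum_mul]
  gcongr
  rw [← NNReal.coe_le_coe, NNReal.coe_sum]
  simpa only [Real.coe_toNNReal _ (sq_nonneg (x _))] using hx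

lemma pi_gaussianReal_map_add (v : ℝ≥0) (x : ι → ℝ) :
    (Measure.pi fun _ => gaussianReal 0 v).map (x + ·) =
      Measure.pi fun k => gaussianReal (x k) v := by
  have h := Measure.pi_map_pi (μ := fun _ : ι => gaussianReal 0 v) (f := fun k z => x k + z)
    fun _ => by fun_prop
  simp only [gaussianReal_map_const_add, zero_add] at h
  exact h

lemma gaussianReal_eq_withDensity (hv : v ≠ 0) (a : ℝ) :
    gaussianReal a v = (gaussianReal 0 v).withDensity
      fun z => ENNReal.ofReal (Real.exp (a * z / v - a ^ 2 / (2 * v))) := by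
  rw [gaussianReal_of_var_ne_zero _ hv, gaussianReal_of_var_ne_zero _ hv,
    ← withDensity_mul _ (measurable_gaussianPDF _ _) (by fun_prop)]
  congr 1
  ext z
  have hexponent : -(z - a) ^ 2 / (2 * (v : ℝ)) =
      -(z - 0) ^ 2 / (2 * v) + (a * z / v - a ^ 2 / (2 * v)) := by
    field_simp
    ring
  rw [Pi.mul_apply, gaussianPDF, gaussianPDF, ← ENNReal.ofReal_mul (gaussianPDFReal_nonneg _ _ _),
    gaussianPDFReal, gaussianPDFReal, hexponent, Real.exp_add, ← mul_assoc]

lemma integrable_exp_affine_gaussianReal (v : ℝ≥0) (a b c : ℝ) :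
    Integrable (fun z => Real.exp (a * z / b - c)) (gaussianReal 0 v) := by
  refine ((integrable_exp_mul_gaussianReal (a / b)).mul_const (Real.exp (-c))).congr
    (ae_of_all _ fun z => ?_)
  simp only [← Real.exp_add]
  congr 1
  ring

/-- Logarithm of the likelihood ratio, at the output sequence `y`, of the input sequence `x` to the
zero input, for additive i.i.d. Gaussian noise of variance `v`. -/
noncomputable def logLikelihoodRatio (v : ℝ≥0) (x y : ι → ℝ) : ℝ :=
  ∑ k, (x k * y k / v - x k ^ 2 / (2 * v))

lemma logLikelihoodRatio_self_add (hv : v ≠ 0) (x z : ι → ℝ) :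
    logLikelihoodRatio v x (x + z) = (∑ k, x k ^ 2 + 2 * ∑ k, x k * z k) / (2 * v) := by
  rw [logLikelihoodRatio, Finset.mul_sum, ← Finset.sum_add_distrib, Finset.sum_div]
  refine Finset.sum_congr rfl fun k _ => ?_
  rw [Pi.add_apply]
  field_simp
  ring

lemma pi_gaussianReal_map_add_eq_withDensity (hv : v ≠ 0) (x : ι → ℝ) :
    (Measure.pi fun _ => gaussianReal 0 v).map (x + ·) =
      (Measure.pi fun _ => gaussianReal 0 v).withDensity
        fun y => ENNReal.ofReal (Real.exp (logLikelihoodRatio v x y)) := by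
  rw [pi_gaussianReal_map_add]
  simp_rw [gaussianReal_eq_withDensity hv (x _), logLikelihoodRatio, Real.exp_sum]
  exact pi_withDensity_ofReal (fun _ => gaussianReal 0 v)
    (f := fun k z => Real.exp (x k * z / v - x k ^ 2 / (2 * v)))
    (fun k => integrable_exp_affine_gaussianReal _ _ _ _) fun k z => (Real.exp_pos _).le

lemma pi_gaussianReal_map_add_measureReal_le (hv : v ≠ 0) {E : ℝ≥0} {x : ι → ℝ}
    (hx : ∑ k, x k ^ 2 ≤ (E : ℝ)) {γ : ℝ} (hγ : 0 ≤ γ) (A : Set (ι → ℝ)) :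
    ((Measure.pi fun _ => gaussianReal 0 v).map (x + ·)).real A ≤
      Real.exp (-γ ^ 2 / (2 * (E * v))) +
        Real.exp ((E + 2 * γ) / (2 * v)) * (Measure.pi fun _ => gaussianReal 0 v).real A := by
  set Q : Measure (ι → ℝ) := Measure.pi fun _ => gaussianReal 0 v
  set P := Q.map (x + ·)
  set T := Real.exp ((E + 2 * γ) / (2 * v)) with hT
  have hadd : Measurable (x + · : (ι → ℝ) → ι → ℝ) := by fun_prop
  have hP : P = Q.withDensity fun y => ENNReal.ofReal (Real.exp (logLikelihoodRatio v x y)) :=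
    pi_gaussianReal_map_add_eq_withDensity hv x
  have hPprob : IsProbabilityMeasure P := Measure.isProbabilityMeasure_map hadd.aemeasurable
  have htail : P.real {y | T < Real.exp (logLikelihoodRatio v x y)} ≤
      Real.exp (-γ ^ 2 / (2 * (E * v))) := by
    have hmeas : MeasurableSet {y | T < Real.exp (logLikelihoodRatio v x y)} := by
      unfold logLikelihoodRatio
      exact measurableSet_lt measurable_const (by fun_prop)
    rw [map_measureReal_apply hadd hmeas]
    refine (measureReal_mono fun z hz => ?_).trans
      ((hasSubgaussianMGF_sum_mul hx).measure_ge_le hγ)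
    rw [Set.mem_preimage, Set.mem_ofPred_eq, hT, Real.exp_lt_exp, logLikelihoodRatio_self_add hv,
      div_lt_div_iff_of_pos_right (by positivity)] at hz
    rw [Set.mem_ofPred_eq]
    linarith
  rw [hP] at htail hPprob ⊢
  exact (withDensity_measureReal_le Q _ (Real.exp_pos _).le A).trans (by gcongr)

end Gaussian

/-! ### Strong converse -/

section Converse

variable {σ : ℝ} {E : ℝ≥0}

instance (σ : ℝ) (n : ℕ) : IsProbabilityMeasure (noise σ n) := by
  unfold noise; infer_instance

lemma Encoder.le_rate_iff (c : Encoder E) (hE : 0 < E) {R : ℝ} :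
    R ≤ c.rate ↔ Real.exp (R * E) ≤ c.M := by
  rw [Encoder.rate, le_div_iff₀ (NNReal.coe_pos.2 hE),
    Real.le_log_iff_exp_le (Nat.cast_pos.2 c.M_pos)]

lemma UnquantizedCode.errorProb_le_one (c : UnquantizedCode E) (σ : ℝ) : c.errorProb σ ≤ 1 := by
  refine div_le_one_of_le₀ ?_ (Nat.cast_nonneg _)
  calc ∑ m, (noise σ c.n).real {z | c.decoder (fun k => c.codeword m k + z k) ≠ m}
      ≤ ∑ _m : Fin c.M, (1 : ℝ) := Finset.sum_le_sum fun _ _ => measureReal_le_one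
    _ = c.M := by simp

lemma UnquantizedCode.one_le_errorProb_add (hσ : 0 < σ) (c : UnquantizedCode E) {γ : ℝ}
    (hγ : 0 ≤ γ) :
    1 ≤ c.errorProb σ + Real.exp (-γ ^ 2 / (2 * (E * σ ^ 2))) +
      Real.exp ((E + 2 * γ) / (2 * σ ^ 2)) / c.M := by
  have hM : (0 : ℝ) < c.M := Nat.cast_pos.2 c.M_pos
  have hv : (σ ^ 2).toNNReal ≠ 0 := by simpa using hσ.ne'
  have hadd (m : Fin c.M) : Measurable (c.codeword m + · : (Fin c.n → ℝ) → Fin c.n → ℝ) := by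
    fun_prop
  have hP (m : Fin c.M) : IsProbabilityMeasure ((noise σ c.n).map (c.codeword m + ·)) :=
    Measure.isProbabilityMeasure_map (hadd m).aemeasurable
  have hbound (m : Fin c.M) : ((noise σ c.n).map (c.codeword m + ·)).real (c.decoder ⁻¹' {m}) ≤
      Real.exp (-γ ^ 2 / (2 * (E * σ ^ 2))) +
        Real.exp ((E + 2 * γ) / (2 * σ ^ 2)) * (noise σ c.n).real (c.decoder ⁻¹' {m}) := by
    have h := pi_gaussianReal_map_add_measureReal_le hv (c.energy_le m) hγ (c.decoder ⁻¹' {m})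
    rwa [Real.coe_toNNReal _ (sq_nonneg σ)] at h
  have herr (m : Fin c.M) :
      ((noise σ c.n).map (c.codeword m + ·)).real {y | c.decoder y ≠ m} =
        (noise σ c.n).real {z | c.decoder (fun k => c.codeword m k + z k) ≠ m} :=
    map_measureReal_apply (hadd m) (c.measurable_decoder (measurableSet_singleton m).compl)
  have hcard := card_le_sum_measureReal_ne_add c.measurable_decoder hbound
  simp only [herr, Fintype.card_fin] at hcard
  rw [UnquantizedCode.errorProb, div_add' _ _ _ hM.ne', ← add_div, one_le_div hM]
  linarith

lemma tendsto_exp_neg_mul_coe {a : ℝ} (ha : 0 < a) :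
    Tendsto (fun E : ℝ≥0 => Real.exp (-(a * E))) atTop (𝓝 0) :=
  Real.tendsto_exp_neg_atTop_nhds_zero.comp
    ((NNReal.tendsto_coe_atTop.2 tendsto_id).const_mul_atTop ha)

theorem tendsto_errorProb_one_of_lt_rate (hσ : 0 < σ) {R : ℝ} (hR : 1 / (2 * σ ^ 2) < R)
    {code : ∀ E : ℝ≥0, UnquantizedCode E} (hrate : ∀ᶠ E in atTop, R ≤ (code E).rate) :
    Tendsto (fun E => (code E).errorProb σ) atTop (𝓝 1) := by
  set Δ := R - 1 / (2 * σ ^ 2) with hΔ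
  have hΔpos : 0 < Δ := sub_pos.2 hR
  set κ := σ ^ 2 * Δ / 2 with hκ
  have hlower : ∀ᶠ E : ℝ≥0 in atTop,
      1 - Real.exp (-(κ ^ 2 / (2 * σ ^ 2) * E)) - Real.exp (-(Δ / 2 * E)) ≤
        (code E).errorProb σ := by
    filter_upwards [hrate, eventually_gt_atTop 0] with E hr hE
    have : (0 : ℝ) < E := hE
    have htail : -(κ * E) ^ 2 / (2 * (E * σ ^ 2)) = -(κ ^ 2 / (2 * σ ^ 2) * E) := by field_simp
    have hcount : Real.exp ((E + 2 * (κ * E)) / (2 * σ ^ 2)) / (code E).M ≤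
        Real.exp (-(Δ / 2 * E)) := by
      have hexponent : (E + 2 * (κ * E)) / (2 * σ ^ 2) = -(Δ / 2 * E) + R * E := by
        rw [hκ, show R = Δ + 1 / (2 * σ ^ 2) by rw [hΔ]; ring]
        field_simp
        ring
      rw [div_le_iff₀ (Nat.cast_pos.2 (code E).M_pos), hexponent, Real.exp_add]
      gcongr
      exact ((code E).le_rate_iff hE).1 hr
    have h := (code E).one_le_errorProb_add hσ (γ := κ * E) (by positivity)
    rw [htail] at h
    linarith
  have hlim := ((tendsto_const_nhds (x := (1 : ℝ))).sub (tendsto_exp_neg_mul_coe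
    (a := κ ^ 2 / (2 * σ ^ 2)) (by positivity))).sub (tendsto_exp_neg_mul_coe (half_pos hΔpos))
  simp only [sub_zero] at hlim
  exact tendsto_of_tendsto_of_tendsto_of_le_of_le' hlim tendsto_const_nhds hlower
    (Eventually.of_forall fun E => (code E).errorProb_le_one σ)

theorem IsAchievableUnquantized.le (hσ : 0 < σ) {R : ℝ} (hR : IsAchievableUnquantized σ R) :
    R ≤ 1 / (2 * σ ^ 2) := by
  by_contra! hlt
  obtain ⟨R', hCR', hR'R⟩ := exists_between hlt
  obtain ⟨code, hrate, herr⟩ := hR (R - R') (sub_pos.2 hR'R)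
  have hrate' : ∀ᶠ E in atTop, R' ≤ (code E).rate :=
    hrate.mono fun E hE => by linarith
  exact zero_ne_one (tendsto_nhds_unique herr (tendsto_errorProb_one_of_lt_rate hσ hCR' hrate'))

end Converse

/-! ### Quantized codes as unquantized codes -/

section Quantize

lemma quantize_eq_one_iff {D : Set ℝ} {y : ℝ} : quantize D y = 1 ↔ y ∈ D := by
  unfold quantize
  split_ifs with h
  · simp only [h]
  · simp only [h, iff_false]
    decide

lemma measurable_quantize {D : Set ℝ} (hD : MeasurableSet D) : Measurable (quantize D) :=
  Measurable.ite hD measurable_const measurable_const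

instance {G : Type*} [Monoid G] [MeasurableSpace G] [MeasurableSingletonClass G] :
    MeasurableSingletonClass Gˣ where
  measurableSet_singleton u := ⟨{(u : G)}, measurableSet_singleton _, by ext; simp [Units.ext_iff]⟩

/-- The unquantized code whose decoder quantizes the channel outputs by itself. It turns the
converse for the unquantized channel into one for the quantized channel. -/
noncomputable def QuantizedCode.toUnquantizedCode {E : ℝ≥0} (c : QuantizedCode E) :
    UnquantizedCode E where
  toEncoder := c.toEncoder
  decoder y := c.decoder fun k => quantize c.region (y k)
  measurable_decoder := (measurable_of_countable c.decoder).comp <| measurable_pi_lambda _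
    fun k => (measurable_quantize c.measurableSet_region).comp (measurable_pi_apply k)

variable {σ R : ℝ}

lemma IsAchievable.isAchievableUnquantized (h : IsAchievable σ R) :
    IsAchievableUnquantized σ R := fun ε hε =>
  let ⟨code, hrate, herr⟩ := h ε hε
  ⟨fun E => (code E).toUnquantizedCode, hrate, herr⟩

lemma IsAchievableByThreshold.isAchievable (h : IsAchievableByThreshold σ R) :
    IsAchievable σ R := fun ε hε =>
  let ⟨_, code, _, hrate, herr⟩ := h ε hε
  ⟨code, hrate, herr⟩

end Quantize

/-! ### Relative frequencies in product spaces -/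

section Frequency

variable {ι α β : Type*} {J : Finset ι} {τ : ℝ}

open Classical in
/-- The event that a fraction at least `τ` of the coordinates in `J` falls into `A`. Both the
decoding rule and the error events of pulse-position modulation are of this form. -/
def frequencyGE (J : Finset ι) (A : Set α) (τ : ℝ) : Set (ι → α) :=
  {z | τ * J.card ≤ (J.filter fun k => z k ∈ A).card}

lemma mem_frequencyGE_congr {x : ι → α} {y : ι → β} {A : Set α} {B : Set β}
    (h : ∀ k ∈ J, x k ∈ A ↔ y k ∈ B) : x ∈ frequencyGE J A τ ↔ y ∈ frequencyGE J B τ := by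
  classical
  rw [frequencyGE, frequencyGE, Set.mem_ofPred_eq, Set.mem_ofPred_eq, Finset.filter_congr h]

lemma compl_frequencyGE_subset (J : Finset ι) (A : Set α) (τ : ℝ) :
    (frequencyGE J A τ)ᶜ ⊆ frequencyGE J Aᶜ (1 - τ) := by
  classical
  intro z hz
  have hcard := congrArg (Nat.cast (R := ℝ))
    (Finset.card_filter_add_card_filter_not (s := J) fun k => z k ∈ A)
  push_cast at hcard
  simp only [frequencyGE, Set.mem_compl_iff, Set.mem_ofPred_eq, not_le] at hz ⊢
  linarith

lemma frequencyGE_eq_iUnion (J : Finset ι) (A : Set α) (τ : ℝ) :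
    frequencyGE J A τ =
      ⋃ I ∈ J.powerset.filter fun I => τ * J.card ≤ I.card, (I : Set ι).pi fun _ => A := by
  classical
  ext z
  simp only [frequencyGE, Set.mem_ofPred_eq, Set.mem_iUnion, Finset.mem_filter,
    Finset.mem_powerset, exists_prop, Set.mem_pi, Finset.mem_coe]
  refine ⟨fun h => ⟨_, ⟨Finset.filter_subset _ _, h⟩, fun k hk => (Finset.mem_filter.1 hk).2⟩, ?_⟩
  rintro ⟨I, ⟨hIJ, hI⟩, hIA⟩
  refine hI.trans (Nat.cast_le.2 (Finset.card_le_card fun k hk => ?_))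
  exact Finset.mem_filter.2 ⟨hIJ hk, hIA k hk⟩

variable [Fintype ι] [MeasurableSpace α] (μ : Measure α) [IsProbabilityMeasure μ]

lemma measureReal_pi_finset_pi (I : Finset ι) (A : Set α) :
    (Measure.pi fun _ : ι => μ).real ((I : Set ι).pi fun _ => A) = μ.real A ^ I.card := by
  classical
  rw [← Set.univ_pi_ite, Measure.real, Measure.pi_pi, ENNReal.toReal_prod]
  simp [apply_ite, Measure.real, Finset.prod_ite_mem]

lemma measureReal_pi_frequencyGE_le (J : Finset ι) {A : Set α} (τ : ℝ) {p : ℝ} (hp : 0 < p)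
    (hp1 : p ≤ 1) (hA : μ.real A ≤ p) :
    (Measure.pi fun _ : ι => μ).real (frequencyGE J A τ) ≤ (2 * p ^ τ) ^ J.card := by
  set F := J.powerset.filter fun I => τ * J.card ≤ I.card
  have hpi (I : Finset ι) (hI : I ∈ F) :
      (Measure.pi fun _ : ι => μ).real ((I : Set ι).pi fun _ => A) ≤ (p ^ τ) ^ J.card :=
    calc (Measure.pi fun _ : ι => μ).real ((I : Set ι).pi fun _ => A)
        = μ.real A ^ I.card := measureReal_pi_finset_pi μ I A
      _ ≤ p ^ I.card := by gcongr
      _ = p ^ (I.card : ℝ) := (Real.rpow_natCast _ _).symm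
      _ ≤ p ^ (τ * J.card) :=
        Real.rpow_le_rpow_of_exponent_ge hp hp1 (Finset.mem_filter.1 hI).2
      _ = (p ^ τ) ^ J.card := by rw [Real.rpow_mul hp.le, Real.rpow_natCast]
  have hF : (F.card : ℝ) ≤ 2 ^ J.card := by
    exact_mod_cast (Finset.card_filter_le _ _).trans_eq (Finset.card_powerset J)
  calc (Measure.pi fun _ : ι => μ).real (frequencyGE J A τ)
      ≤ ∑ I ∈ F, (Measure.pi fun _ : ι => μ).real ((I : Set ι).pi fun _ => A) := by
        rw [frequencyGE_eq_iUnion]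
        exact measureReal_biUnion_finset_le _ _
    _ ≤ ∑ _I ∈ F, (p ^ τ) ^ J.card := Finset.sum_le_sum hpi
    _ = F.card * (p ^ τ) ^ J.card := by rw [Finset.sum_const, nsmul_eq_mul]
    _ ≤ 2 ^ J.card * (p ^ τ) ^ J.card := by gcongr
    _ = (2 * p ^ τ) ^ J.card := (mul_pow _ _ _).symm

end Frequency

/-! ### Pulse-position modulation -/

section PulsePosition

variable {σ ξ Υ τ η ρ : ℝ} {E : ℝ≥0} {M L : ℕ}

lemma QuantizedCode.errorProb_nonneg (c : QuantizedCode E) (σ : ℝ) : 0 ≤ c.errorProb σ :=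
  div_nonneg (Finset.sum_nonneg fun _ _ => measureReal_nonneg) (Nat.cast_nonneg _)

lemma QuantizedCode.errorProb_le (c : QuantizedCode E) {b : ℝ}
    (h : ∀ m, (noise σ c.n).real
      {z | c.decoder (fun k => quantize c.region (c.codeword m k + z k)) ≠ m} ≤ b) :
    c.errorProb σ ≤ b := by
  rw [QuantizedCode.errorProb, div_le_iff₀ (Nat.cast_pos.2 c.M_pos)]
  refine (Finset.sum_le_sum fun m _ => h m).trans_eq ?_
  rw [Finset.sum_const, Finset.card_univ, Fintype.card_fin, nsmul_eq_mul, mul_comm]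

/-- The `m`-th of `M` consecutive blocks of `L` time instants: the time in which pulse-position
modulation sends the pulses of message `m`. -/
def block (M L : ℕ) (m : Fin M) : Finset (Fin (M * L)) :=
  Finset.univ.map ((Function.Embedding.sectR m (Fin L)).trans finProdFinEquiv.toEmbedding)

lemma card_block (m : Fin M) : (block M L m).card = L := by
  rw [block, Finset.card_map, Finset.card_univ, Fintype.card_fin]

lemma mem_block_iff {m : Fin M} {k : Fin (M * L)} : k ∈ block M L m ↔ k.divNat = m := by
  obtain ⟨⟨i, l⟩, rfl⟩ := finProdFinEquiv.surjective k
  have h : (finProdFinEquiv (i, l)).divNat = i :=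
    congrArg Prod.fst (finProdFinEquiv.symm_apply_apply (i, l))
  simp [block, h, eq_comm]

open Classical in
/-- The decoding rule of pulse-position modulation: look for a block in which a fraction at least
`τ` of the outputs is `1`. If there is no such block, which counts as an error in the analysis, an
arbitrary message is returned. -/
noncomputable def blockDecoder (L : ℕ) (hM : 0 < M) (τ : ℝ) (y : Fin (M * L) → ℤˣ) : Fin M :=
  if h : ∃ m, y ∈ frequencyGE (block M L m) {1} τ then h.choose else ⟨0, hM⟩

lemma blockDecoder_eq {hM : 0 < M} {m : Fin M} {y : Fin (M * L) → ℤˣ}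
    (h : ∀ m', y ∈ frequencyGE (block M L m') {1} τ ↔ m' = m) : blockDecoder L hM τ y = m := by
  have hex : ∃ m', y ∈ frequencyGE (block M L m') {1} τ := ⟨m, (h m).2 rfl⟩
  rw [blockDecoder, dif_pos hex]
  exact (h _).1 hex.choose_spec

/-- Pulse-position modulation with the threshold quantizer `{y | Υ ≤ y}`: message `m` is sent as
pulses of amplitude `ξ` in the `m`-th block of `L` time instants, and the transmitter is silent
otherwise. This code achieves the capacity per unit-energy. -/
noncomputable def pulsePositionCode (ξ Υ τ : ℝ) (hM : 0 < M) (hL : L * ξ ^ 2 ≤ E) :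
    QuantizedCode E where
  n := M * L
  M := M
  M_pos := hM
  codeword m k := if k ∈ block M L m then ξ else 0
  energy_le m := by simpa [ite_pow, Finset.sum_ite_mem, card_block] using hL
  region := {y | Υ ≤ y}
  measurableSet_region := measurableSet_Ici
  decoder := blockDecoder L hM τ

lemma pulsePositionCode_received_mem_frequencyGE_iff (hM : 0 < M) (hL : L * ξ ^ 2 ≤ E)
    (m m' : Fin M) (z : Fin (M * L) → ℝ) :
    (fun k => quantize {y | Υ ≤ y} ((pulsePositionCode ξ Υ τ hM hL).codeword m k + z k)) ∈
        frequencyGE (block M L m') {1} τ ↔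
      z ∈ frequencyGE (block M L m') (Set.Ici (Υ - if m' = m then ξ else 0)) τ := by
  refine mem_frequencyGE_congr fun k hk => ?_
  have hkm : k ∈ block M L m ↔ m' = m := by rw [mem_block_iff, mem_block_iff.1 hk]
  simp only [pulsePositionCode, Set.mem_singleton_iff, quantize_eq_one_iff, Set.mem_ofPred_eq, hkm,
    Set.mem_Ici, sub_le_iff_le_add']

lemma pulsePositionCode_error_subset (hM : 0 < M) (hL : L * ξ ^ 2 ≤ E) (m : Fin M) :
    {z : Fin (M * L) → ℝ | blockDecoder L hM τ (fun k =>
        quantize {y | Υ ≤ y} ((pulsePositionCode ξ Υ τ hM hL).codeword m k + z k)) ≠ m} ⊆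
      frequencyGE (block M L m) (Set.Iio (Υ - ξ)) (1 - τ) ∪
        ⋃ m' ∈ Finset.univ.erase m, frequencyGE (block M L m') (Set.Ici Υ) τ := by
  intro z hz
  contrapose! hz
  simp only [Set.mem_union, Set.mem_iUnion, Finset.mem_erase, Finset.mem_univ, and_true, not_or,
    not_exists] at hz
  obtain ⟨hmiss, hfalse⟩ := hz
  refine not_not.2 (blockDecoder_eq fun m' => ?_)
  refine (pulsePositionCode_received_mem_frequencyGE_iff hM hL m m' z).trans ?_
  rcases eq_or_ne m' m with rfl | hne
  · rw [← Set.compl_Ici] at hmiss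
    simpa using Set.notMem_subset (compl_frequencyGE_subset _ _ _) hmiss
  · simpa [hne] using hfalse m' hne

lemma pulsePositionCode_errorProb_le (hM : 0 < M) (hL : L * ξ ^ 2 ≤ E) {p q : ℝ} (hp : 0 < p)
    (hp1 : p ≤ 1) (hq : 0 < q) (hq1 : q ≤ 1)
    (hmiss : (gaussianReal 0 (σ ^ 2).toNNReal).real (Set.Iio (Υ - ξ)) ≤ p)
    (hfalse : (gaussianReal 0 (σ ^ 2).toNNReal).real (Set.Ici Υ) ≤ q) :
    (pulsePositionCode ξ Υ τ hM hL).errorProb σ ≤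
      (2 * p ^ (1 - τ)) ^ L + M * (2 * q ^ τ) ^ L := by
  refine QuantizedCode.errorProb_le _ fun (m : Fin M) => ?_
  have hmiss' : (noise σ (M * L)).real (frequencyGE (block M L m) (Set.Iio (Υ - ξ)) (1 - τ)) ≤
      (2 * p ^ (1 - τ)) ^ L := by
    have h := measureReal_pi_frequencyGE_le _ (block M L m) (1 - τ) hp hp1 hmiss
    rwa [card_block] at h
  have hfalse' (m' : Fin M) : (noise σ (M * L)).real (frequencyGE (block M L m') (Set.Ici Υ) τ) ≤
      (2 * q ^ τ) ^ L := by
    have h := measureReal_pi_frequencyGE_le _ (block M L m') τ hq hq1 hfalse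
    rwa [card_block] at h
  have hunion : (noise σ (M * L)).real (⋃ m' ∈ Finset.univ.erase m,
      frequencyGE (block M L m') (Set.Ici Υ) τ) ≤ M * (2 * q ^ τ) ^ L :=
    calc _ ≤ ∑ m' ∈ Finset.univ.erase m,
            (noise σ (M * L)).real (frequencyGE (block M L m') (Set.Ici Υ) τ) :=
          measureReal_biUnion_finset_le _ _
      _ ≤ ∑ m', (noise σ (M * L)).real (frequencyGE (block M L m') (Set.Ici Υ) τ) :=
          Finset.sum_le_univ_sum_of_nonneg fun _ => measureReal_nonneg
      _ ≤ ∑ _m' : Fin M, (2 * q ^ τ) ^ L := Finset.sum_le_sum fun m' _ => hfalse' m'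
      _ = M * (2 * q ^ τ) ^ L := by simp
  exact ((measureReal_mono (pulsePositionCode_error_subset hM hL m)).trans
    (measureReal_union_le _ _)).trans (add_le_add hmiss' hunion)

lemma pulsePositionCode_errorProb_le_exp (hM : 0 < M) (hL : L * ξ ^ 2 ≤ E) (hξ : 0 ≤ ξ)
    (hη : 0 ≤ η) (hη1 : η ≤ 1) :
    (pulsePositionCode ξ ((1 - η) * ξ) (1 - η) hM hL).errorProb σ ≤
      (2 * Real.exp (-(η ^ 3 * ξ ^ 2 / (2 * σ ^ 2)))) ^ L +
        M * (2 * Real.exp (-((1 - η) ^ 3 * ξ ^ 2 / (2 * σ ^ 2)))) ^ L := by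
  have hchernoff (a : ℝ) : Real.exp (-(a * ξ) ^ 2 / (2 * (σ ^ 2).toNNReal)) ^ a =
      Real.exp (-(a ^ 3 * ξ ^ 2 / (2 * σ ^ 2))) := by
    rw [Real.coe_toNNReal _ (sq_nonneg σ), ← Real.exp_mul]
    congr 1
    ring
  have hle_one (a : ℝ) : Real.exp (-a ^ 2 / (2 * (σ ^ 2).toNNReal)) ≤ 1 :=
    Real.exp_le_one_iff.2 (div_nonpos_of_nonpos_of_nonneg (by simp [sq_nonneg]) (by positivity))
  have hmiss : (gaussianReal 0 (σ ^ 2).toNNReal).real (Set.Iio ((1 - η) * ξ - ξ)) ≤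
      Real.exp (-(η * ξ) ^ 2 / (2 * (σ ^ 2).toNNReal)) := by
    rw [show (1 - η) * ξ - ξ = -(η * ξ) by ring]
    exact gaussianReal_Iio_neg_le _ (mul_nonneg hη hξ)
  have hfalse := gaussianReal_Ici_le (σ ^ 2).toNNReal (mul_nonneg (sub_nonneg.2 hη1) hξ)
  refine (pulsePositionCode_errorProb_le hM hL (Real.exp_pos _) (hle_one _) (Real.exp_pos _)
    (hle_one _) hmiss hfalse).trans_eq ?_
  rw [sub_sub_cancel, hchernoff, hchernoff]

/-- The pulse-position code of energy `E` and rate per unit-energy at least `ρ`, with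
`⌈exp (ρ E)⌉` messages, blocks of length `⌊E / ξ²⌋`, and `1 - η` both as the relative height of the
threshold and as the fraction required by the decoder. -/
noncomputable def pulsePositionCodeOfRate (ρ ξ η : ℝ) (E : ℝ≥0) : QuantizedCode E :=
  pulsePositionCode (M := ⌈Real.exp (ρ * E)⌉₊) (L := ⌊(E : ℝ) / ξ ^ 2⌋₊) ξ ((1 - η) * ξ) (1 - η)
    (Nat.ceil_pos.2 (Real.exp_pos _))
    (mul_le_of_le_div₀ E.coe_nonneg (sq_nonneg ξ) (Nat.floor_le (by positivity)))

lemma le_rate_pulsePositionCodeOfRate (ρ ξ η : ℝ) (hE : 0 < E) :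
    ρ ≤ (pulsePositionCodeOfRate ρ ξ η E).rate :=
  (Encoder.le_rate_iff _ hE).2 (Nat.le_ceil _)

lemma tendsto_ceil_exp_mul_pow_floor {s b : ℝ} (hρ : 0 ≤ ρ) (hs : 0 < s) (hb : 0 ≤ b)
    (h : Real.exp (ρ * s) * b < 1) :
    Tendsto (fun x : ℝ => (⌈Real.exp (ρ * x)⌉₊ : ℝ) * b ^ ⌊x / s⌋₊) atTop (𝓝 0) := by
  have hlim : Tendsto (fun x : ℝ => 2 * Real.exp (ρ * s) * (Real.exp (ρ * s) * b) ^ ⌊x / s⌋₊)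
      atTop (𝓝 0) := by
    simpa only [mul_zero, Function.comp_apply, id_eq] using
      ((tendsto_pow_atTop_nhds_zero_of_lt_one (by positivity) h).comp
        (tendsto_nat_floor_atTop.comp (tendsto_id.atTop_div_const hs))).const_mul _
  refine squeeze_zero' (Eventually.of_forall fun x => by positivity) ?_ hlim
  filter_upwards [eventually_ge_atTop 0] with x hx
  have hceil : (⌈Real.exp (ρ * x)⌉₊ : ℝ) ≤ 2 * Real.exp (ρ * x) := by
    linarith [Nat.ceil_lt_add_one (Real.exp_pos (ρ * x)).le, Real.one_le_exp (mul_nonneg hρ hx)]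
  have hfloor : x ≤ s + ⌊x / s⌋₊ * s := by
    have := (div_lt_iff₀ hs).1 (Nat.lt_floor_add_one (x / s))
    linarith
  calc (⌈Real.exp (ρ * x)⌉₊ : ℝ) * b ^ ⌊x / s⌋₊
      ≤ 2 * Real.exp (ρ * (s + ⌊x / s⌋₊ * s)) * b ^ ⌊x / s⌋₊ := by
        refine mul_le_mul_of_nonneg_right (hceil.trans ?_) (by positivity)
        gcongr
    _ = 2 * Real.exp (ρ * s) * (Real.exp (ρ * s) * b) ^ ⌊x / s⌋₊ := by
        rw [mul_add, Real.exp_add, mul_pow, ← Real.exp_nat_mul]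
        ring_nf

lemma tendsto_errorProb_pulsePositionCodeOfRate (hρ : 0 ≤ ρ) (hξ : 0 < ξ) (hη : 0 ≤ η)
    (hη1 : η ≤ 1) (hmiss : 2 * Real.exp (-(η ^ 3 * ξ ^ 2 / (2 * σ ^ 2))) < 1)
    (hfalse : Real.exp (ρ * ξ ^ 2) * (2 * Real.exp (-((1 - η) ^ 3 * ξ ^ 2 / (2 * σ ^ 2)))) < 1) :
    Tendsto (fun E => (pulsePositionCodeOfRate ρ ξ η E).errorProb σ) atTop (𝓝 0) := by
  have hcoe : Tendsto ((↑) : ℝ≥0 → ℝ) atTop atTop := NNReal.tendsto_coe_atTop.2 tendsto_id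
  have hξ2 : 0 < ξ ^ 2 := by positivity
  have hlim_miss := (tendsto_pow_atTop_nhds_zero_of_lt_one (by positivity) hmiss).comp
    (tendsto_nat_floor_atTop.comp (hcoe.atTop_div_const hξ2))
  have hlim_false := (tendsto_ceil_exp_mul_pow_floor hρ hξ2 (by positivity) hfalse).comp hcoe
  exact squeeze_zero (fun E => QuantizedCode.errorProb_nonneg _ _)
    (fun E => pulsePositionCode_errorProb_le_exp _ _ hξ.le hη hη1)
    (by simpa using hlim_miss.add hlim_false)

lemma eventually_two_mul_exp_neg_mul_sq_lt_one {a : ℝ} (ha : 0 < a) :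
    ∀ᶠ ξ : ℝ in atTop, 2 * Real.exp (-(a * ξ ^ 2)) < 1 := by
  have h : Tendsto (fun ξ : ℝ => 2 * Real.exp (-(a * ξ ^ 2))) atTop (𝓝 0) := by
    simpa using (Real.tendsto_exp_neg_atTop_nhds_zero.comp
      ((tendsto_pow_atTop two_ne_zero).const_mul_atTop ha)).const_mul 2
  exact h.eventually_lt_const one_pos

lemma exists_pulse_parameters {V : ℝ} (hV : 0 < V) (hρ : ρ < 1 / V) :
    ∃ η ∈ Set.Ioo (0 : ℝ) 1, ∃ ξ > 0, 2 * Real.exp (-(η ^ 3 * ξ ^ 2 / V)) < 1 ∧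
      Real.exp (ρ * ξ ^ 2) * (2 * Real.exp (-((1 - η) ^ 3 * ξ ^ 2 / V))) < 1 := by
  have hcont : ContinuousAt (fun η : ℝ => (1 - η) ^ 3 / V) 0 := by fun_prop
  have hnear : ∀ᶠ η in 𝓝[>] (0 : ℝ), ρ < (1 - η) ^ 3 / V :=
    nhdsWithin_le_nhds (hcont.eventually_const_lt (by simpa using hρ))
  obtain ⟨η, hηρ, hη⟩ := (hnear.and (Ioo_mem_nhdsGT one_pos)).exists
  have hη0 : 0 < η := hη.1
  obtain ⟨ξ, hmiss, hfalse, hξ⟩ := ((eventually_two_mul_exp_neg_mul_sq_lt_one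
    (a := η ^ 3 / V) (by positivity)).and <| (eventually_two_mul_exp_neg_mul_sq_lt_one
    (sub_pos.2 hηρ)).and (eventually_gt_atTop 0)).exists
  refine ⟨η, hη, ξ, hξ, by simpa only [div_mul_eq_mul_div] using hmiss, ?_⟩
  rw [mul_left_comm, ← Real.exp_add]
  convert hfalse using 3
  ring

theorem isAchievableByThreshold (hσ : 0 < σ) : IsAchievableByThreshold σ (1 / (2 * σ ^ 2)) := by
  intro ε hε
  have hC : 0 < 1 / (2 * σ ^ 2) := by positivity
  obtain ⟨ρ, hρ, hρC⟩ := exists_between (max_lt (sub_lt_self _ hε) hC)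
  obtain ⟨hερ, hρ0⟩ := max_lt_iff.1 hρ
  obtain ⟨η, ⟨hη0, hη1⟩, ξ, hξ, hmiss, hfalse⟩ := exists_pulse_parameters (by positivity) hρC
  refine ⟨(1 - η) * ξ, pulsePositionCodeOfRate ρ ξ η, fun E => rfl, ?_,
    tendsto_errorProb_pulsePositionCodeOfRate hρ0.le hξ hη0.le hη1.le hmiss hfalse⟩
  filter_upwards [eventually_gt_atTop 0] with E hE
  exact hερ.trans_le (le_rate_pulsePositionCodeOfRate ρ ξ η hE)

end PulsePosition

lemma biSup_coe_eq_of_isGreatest {s : Set ℝ} {C : ℝ} (h : IsGreatest s C) :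
    ⨆ R ∈ s, (R : EReal) = C := by
  rw [← sSup_image]
  exact (EReal.coe_strictMono.monotone.map_isGreatest h).csSup_eq

end OneBit

theorem theorem1 (σ : ℝ) (hσ : 0 < σ) :
    OneBit.capacityPerUnitEnergy σ = ((1 / (2 * σ ^ 2) : ℝ) : EReal) ∧
    OneBit.capacityPerUnitEnergyUnquantized σ = ((1 / (2 * σ ^ 2) : ℝ) : EReal) ∧
    OneBit.IsAchievableByThreshold σ (1 / (2 * σ ^ 2)) := by
  have hthreshold := OneBit.isAchievableByThreshold hσ
  have hquantized : IsGreatest {R | OneBit.IsAchievable σ R} (1 / (2 * σ ^ 2)) :=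
    ⟨hthreshold.isAchievable, fun R hR => hR.isAchievableUnquantized.le hσ⟩
  have hunquantized : IsGreatest {R | OneBit.IsAchievableUnquantized σ R} (1 / (2 * σ ^ 2)) :=
    ⟨hthreshold.isAchievable.isAchievableUnquantized, fun R hR => hR.le hσ⟩
  exact ⟨OneBit.biSup_coe_eq_of_isGreatest hquantized,
    OneBit.biSup_coe_eq_of_isGreatest hunquantized, hthreshold⟩
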